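/- Let $n \in \mathbb{N}$ and let $0 < t < s < \frac{n}{2}$. Let $\eta \in C_c^\infty(\mathbb{R}^n)$ satisfy $0 \le \eta(x) \le 1$ for all $x \in \mathbb{R}^n$, $\eta(x) = 1$ for $|x| < 1$ and $\eta(x) = 0$ for $|x| \ge 2$. Let $\alpha \in \left(0, \frac{n}{2}\right)$ and let $\mathbf{f}_\alpha \in \mathcal{S}'(\mathbb{R}^n)$ be the regular distribution generated by $f_\alpha(x) = |x|^{-\alpha}$ for $x \ne 0$, $f_\alpha(0) = 0$. For $r \in \mathbb{R}$ let $H^r_2(\mathbb{R}^n)$ be the Bessel potential space of all $u \in \mathcal{S}'(\mathbb{R}^n)$ such that $J_r u := \mathcal{F}^{-1}\big((1+|\xi|^2)^{r/2}\,\mathcal{F}u\big)$ is given by a function in $L_2(\mathbb{R}^n)$, with the norm $\|u\|_{H^r_2} = \|J_r u\|_{L_2}$. A distribution $\mu$ is called a multiplier from $H^s_2(\mathbb{R}^n)$ to $H^t_2(\mathbb{R}^n)$, written $\mu \in M[H^s_2(\mathbb{R}^n) \to H^t_2(\mathbb{R}^n)]$, if $f \cdot \mu \in H^t_2(\mathbb{R}^n)$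 for every $f \in C_c^\infty(\mathbb{R}^n)$ and there is a constant $C \ge 0$ such that $\|f \cdot \mu\|_{H^t_2} \le C\, \|f\|_{H^s_2}$ for every (complex-valued) $f \in C_c^\infty(\mathbb{R}^n)$. If $\eta \cdot \mathbf{f}_\alpha \in M[H^s_2(\mathbb{R}^n) \to H^t_2(\mathbb{R}^n)]$, then $\alpha \le s - t$. -/

import Mathlib

open MeasureTheory TemperedDistribution
open scoped SchwartzMap ENNReal NNReal ContDiff

noncomputable section

namespace BesselMultiplier

section Regular

variable {E : Type*} [NormedAddCommGroup E] [InnerProductSpace ℝ E] [FiniteDimensional ℝ E]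
  [MeasurableSpace E] [BorelSpace E]

/-- A locally integrable function with at most polynomial growth outside some ball. -/
structure IsTemperedFun (f : E → ℂ) : Prop where
  locallyIntegrable : LocallyIntegrable f volume
  growth : ∃ r : ℝ, 0 < r ∧ ∃ (N : ℕ) (C : ℝ), 0 ≤ C ∧
    ∀ x, r ≤ ‖x‖ → ‖f x‖ ≤ C * (1 + ‖x‖ ^ 2) ^ N

theorem IsTemperedFun.exists_integrable {f : E → ℂ} (hf : IsTemperedFun f) :
    ∃ k : ℕ, Integrable (fun x ↦ ((1 + ‖x‖) ^ k)⁻¹ * ‖f x‖) (volume : Measure E) := by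
  obtain ⟨r, -, N, C, hC, h⟩ := hf.growth
  set d := (volume : Measure E).integrablePower
  refine ⟨2 * N + d, ?_⟩
  have hmeas : AEStronglyMeasurable (fun x ↦ ((1 + ‖x‖) ^ (2 * N + d))⁻¹ * ‖f x‖)
      (volume : Measure E) := by
    refine AEStronglyMeasurable.mul (Continuous.aestronglyMeasurable ?_)
      hf.locallyIntegrable.aestronglyMeasurable.norm
    exact Continuous.inv₀ (by fun_prop) (fun x ↦ by positivity)
  have h1 : Integrable (Set.indicator (Metric.closedBall (0 : E) r) fun x ↦ ‖f x‖) volume :=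
    (integrable_indicator_iff measurableSet_closedBall).2
      (hf.locallyIntegrable.integrableOn_isCompact (isCompact_closedBall 0 r)).norm
  have h2 := (Measure.integrable_pow_neg_integrablePower (volume : Measure E)).const_mul C
  refine (h1.add h2).mono' hmeas (Filter.Eventually.of_forall fun x ↦ ?_)
  have hx1 : (1 : ℝ) ≤ 1 + ‖x‖ := by linarith [norm_nonneg x]
  rw [Real.norm_of_nonneg (by positivity)]
  simp only [Pi.add_apply]
  have hp : (0 : ℝ) ≤ (1 + ‖x‖) ^ (-(d : ℝ)) := by positivity
  by_cases hx : x ∈ Metric.closedBall (0 : E) r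
  · rw [Set.indicator_of_mem hx]
    have : ((1 + ‖x‖) ^ (2 * N + d))⁻¹ ≤ 1 := inv_le_one_of_one_le₀ (one_le_pow₀ hx1)
    have := mul_le_mul_of_nonneg_right this (norm_nonneg (f x))
    have := mul_nonneg hC hp
    linarith
  · rw [Set.indicator_of_notMem hx, zero_add]
    have hr : r ≤ ‖x‖ := by
      rw [mem_closedBall_zero_iff, not_le] at hx
      exact hx.le
    have hle : (1 + ‖x‖ ^ 2) ^ N ≤ (1 + ‖x‖) ^ (2 * N) := by
      rw [pow_mul]
      exact pow_le_pow_left₀ (by positivity) (by nlinarith [norm_nonneg x]) N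
    rw [Real.rpow_neg (by positivity), Real.rpow_natCast, pow_add, mul_inv]
    calc ((1 + ‖x‖) ^ (2 * N))⁻¹ * ((1 + ‖x‖) ^ d)⁻¹ * ‖f x‖
        ≤ ((1 + ‖x‖) ^ (2 * N))⁻¹ * ((1 + ‖x‖) ^ d)⁻¹ * (C * (1 + ‖x‖) ^ (2 * N)) := by
          gcongr
          exact (h x hr).trans (mul_le_mul_of_nonneg_left hle hC)
      _ = C * ((1 + ‖x‖) ^ d)⁻¹ := by
          have : (1 + ‖x‖) ^ (2 * N) ≠ 0 := by positivity
          field_simp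

theorem norm_mul_le_seminorm (k : ℕ) (f : E → ℂ) (φ : 𝓢(E, ℂ)) (x : E) :
    ‖φ x * f x‖ ≤ (2 ^ k * ((Finset.Iic (k, 0)).sup (schwartzSeminormFamily ℂ E ℂ)) φ) *
      (((1 + ‖x‖) ^ k)⁻¹ * ‖f x‖) := by
  have h := SchwartzMap.one_add_le_sup_seminorm_apply (𝕜 := ℂ) (m := (k, 0)) (k := k) (n := 0)
    le_rfl le_rfl φ x
  rw [norm_iteratedFDeriv_zero] at h
  have hp : (0 : ℝ) < (1 + ‖x‖) ^ k := by positivity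
  rw [norm_mul, ← mul_assoc]
  gcongr
  rw [← div_eq_mul_inv, le_div_iff₀ hp, mul_comm]
  exact h

theorem IsTemperedFun.integrable_mul {f : E → ℂ} (hf : IsTemperedFun f) (φ : 𝓢(E, ℂ)) :
    Integrable (fun x ↦ φ x * f x) (volume : Measure E) := by
  obtain ⟨k, hk⟩ := hf.exists_integrable
  refine (hk.const_mul _).mono' ?_
    (Filter.Eventually.of_forall fun x ↦ norm_mul_le_seminorm k f φ x)
  exact φ.continuous.aestronglyMeasurable.mul hf.locallyIntegrable.aestronglyMeasurable

/-- The regular tempered distribution `φ ↦ ∫ φ(x) f(x) dx` generated by `f`. -/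
def regularDistribution (f : E → ℂ) (hf : IsTemperedFun f) : 𝓢'(E, ℂ) :=
  ContinuousLinearMap.toPointwiseConvergenceCLM _ _ _ _
    (SchwartzMap.mkCLMtoNormedSpace (𝕜 := ℂ) (σ := RingHom.id ℂ)
      (fun φ : 𝓢(E, ℂ) ↦ ∫ x, φ x * f x)
      (fun φ ψ ↦ by
        simp only [add_apply, add_mul]
        exact integral_add (hf.integrable_mul φ) (hf.integrable_mul ψ))
      (fun c φ ↦ by
        simp only [smul_apply, smul_eq_mul, mul_assoc, RingHom.id_apply]
        exact integral_const_mul c _)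
      (by
        obtain ⟨k, hk⟩ := hf.exists_integrable
        refine ⟨Finset.Iic (k, 0), 2 ^ k * ∫ x, ((1 + ‖x‖) ^ k)⁻¹ * ‖f x‖, ?_, fun φ ↦ ?_⟩
        · exact mul_nonneg (by positivity) (integral_nonneg fun x ↦ by positivity)
        · refine (norm_integral_le_of_norm_le (hk.const_mul _) (Filter.Eventually.of_forall
            fun x ↦ norm_mul_le_seminorm k f φ x)).trans (le_of_eq ?_)
          rw [integral_const_mul]
          ring))

@[simp]
theorem regularDistribution_apply (f : E → ℂ) (hf : IsTemperedFun f) (φ : 𝓢(E, ℂ)) :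
    regularDistribution f hf φ = ∫ x, φ x * f x := rfl

end Regular

section Sobolev

variable {E : Type*} [NormedAddCommGroup E] [InnerProductSpace ℝ E] [FiniteDimensional ℝ E]
  [MeasurableSpace E] [BorelSpace E]

/-- The norm `‖J_s u‖_{L_p}` of a tempered distribution `u` in the Bessel potential space `H^s_p`;
it is `∞` when `u` is not in `H^s_p`. The representative `g` is unique when it exists, see
`sobolevENorm_eq`. `TemperedDistribution.besselPotential` is the Fourier multiplier
`(1 + ‖ξ‖²)^{s/2}` for the Fourier transform with kernel `e^{-2πi⟨x,ξ⟩}`. -/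
def sobolevENorm (s : ℝ) (p : ℝ≥0∞) [Fact (1 ≤ p)] (u : 𝓢'(E, ℂ)) : ℝ≥0∞ :=
  ⨅ (g : Lp ℂ p (volume : Measure E)) (_ : besselPotential E ℂ s u = (g : 𝓢'(E, ℂ))), ‖g‖ₑ

theorem sobolevENorm_eq {s : ℝ} {p : ℝ≥0∞} [Fact (1 ≤ p)] {u : 𝓢'(E, ℂ)}
    {g : Lp ℂ p (volume : Measure E)} (h : besselPotential E ℂ s u = (g : 𝓢'(E, ℂ))) :
    sobolevENorm s p u = ‖g‖ₑ := by
  refine le_antisymm (iInf₂_le g h) (le_iInf₂ fun g' h' ↦ le_of_eq ?_)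
  have hinj := LinearMap.ker_eq_bot.1
    (Lp.ker_toTemperedDistributionCLM_eq_bot (F := ℂ) (μ := (volume : Measure E)) (p := p))
  have : g = g' := hinj (h.symm.trans h')
  rw [this]

theorem sobolevENorm_lt_top_iff {s : ℝ} {p : ℝ≥0∞} [Fact (1 ≤ p)] {u : 𝓢'(E, ℂ)} :
    sobolevENorm s p u < ⊤ ↔ MemSobolev s p u := by
  simp [sobolevENorm, iInf_lt_iff, MemSobolev, enorm_lt_top]

/-- `u` lies locally in `H^s_p`: `f · u ∈ H^s_p` for every test function `f`. -/
def MemSobolevLoc (s : ℝ) (p : ℝ≥0∞) [Fact (1 ≤ p)] (u : 𝓢'(E, ℂ)) : Prop :=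
  ∀ f : E → ℂ, ContDiff ℝ ∞ f → HasCompactSupport f → MemSobolev s p (smulLeftCLM ℂ f u)

/-- `u` is a multiplier from `H^s_p` to `H^t_q`: it lies locally in `H^t_q`, and there is a
constant `C` with `‖f · u‖_{H^t_q} ≤ C ‖f‖_{H^s_p}` for every test function `f`. -/
def IsMultiplier (s : ℝ) (p : ℝ≥0∞) (t : ℝ) (q : ℝ≥0∞) [Fact (1 ≤ p)] [Fact (1 ≤ q)]
    (u : 𝓢'(E, ℂ)) : Prop :=
  MemSobolevLoc t q u ∧
    ∃ C : ℝ≥0, ∀ (f : E → ℂ) (hf : ContDiff ℝ ∞ f) (hc : HasCompactSupport f),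
      sobolevENorm t q (smulLeftCLM ℂ f u) ≤
        C * sobolevENorm s p ((hc.toSchwartzMap hf : 𝓢(E, ℂ)) : 𝓢'(E, ℂ))

end Sobolev

/-- The function `|x|^{-α}` on `ℝⁿ`, with value `0` at the origin. -/
def powFun (n : ℕ) (α : ℝ) (x : EuclideanSpace ℝ (Fin n)) : ℂ :=
  if x = 0 then 0 else ((1 / ‖x‖ ^ α : ℝ) : ℂ)

theorem isTemperedFun_powFun {n : ℕ} {α : ℝ} (h0 : 0 < α) (hn : α < n) :
    IsTemperedFun (powFun n α) := by
  have hle : ∀ x, ‖powFun n α x‖ ≤ 1 * ‖x‖ ^ (-α) := by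
    intro x
    unfold powFun
    split_ifs with h
    · simp only [norm_zero]; positivity
    · rw [Complex.norm_real, Real.norm_of_nonneg (by positivity),
        Real.rpow_neg (norm_nonneg x), one_div, one_mul]
  constructor
  · refine locallyIntegrable_of_norm_le_rpow (C := 1) (α := α) ?_ ?_
      (Filter.Eventually.of_forall hle) ?_
    · rw [finrank_euclideanSpace_fin]
      have : (0 : ℝ) < n := h0.trans hn
      exact_mod_cast this
    · simpa using hn
    · refine Measurable.aestronglyMeasurable ?_
      unfold powFun
      exact Measurable.ite (measurableSet_singleton 0) (by fun_prop) (by fun_prop)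
  · refine ⟨1, one_pos, 0, 1, zero_le_one, fun x hx ↦ (hle x).trans ?_⟩
    simpa using Real.rpow_le_one_of_one_le_of_nonpos hx (by linarith)

/-- The regular tempered distribution on `ℝⁿ` generated by `|x|^{-α}`, for `0 < α < n`. -/
def powDistribution (n : ℕ) (α : ℝ) (h0 : 0 < α) (hn : α < n) :
    𝓢'(EuclideanSpace ℝ (Fin n), ℂ) :=
  regularDistribution (powFun n α) (isTemperedFun_powFun h0 hn)

end BesselMultiplier

end

noncomputable section

namespace BesselMultiplier

open FourierTransform

/-! Test the multiplier bound on shrinking bumps. For `φ` supported in the unit ball put `φ_ε =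
φ(·/ε)` with `0 < ε ≤ 1`, and pair `φ_ε · η|x|^{-α}` with `φ_ε` itself. Since `η = 1` wherever `φ_ε
≠ 0`, homogeneity gives exactly `ε^(n-α) ∫ φ²|x|^{-α}`, and this integral is nonzero
(`smulLeftCLM_powDistribution_dilation`, `integral_bump_sq_mul_powFun_ne_zero`). Duality of `H^t`
and `H^{-t}` followed by the multiplier bound dominates the pairing by `C ‖φ_ε‖_{H^{-t}}
‖φ_ε‖_{H^s}`. Scaling on the Fourier side bounds these norms by multiples of `ε^(n/2+t)` and
`ε^(n/2-s)`. Hence a positive constant is at most `K ε^(α-(s-t))` for all small `ε`, which forces `α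
≤ s - t`. -/

/-- The Bessel weight `(1 + ‖ξ‖²)^{r/2}` as a complex-valued symbol. -/
def besselSymbol (E : Type*) [NormedAddCommGroup E] (r : ℝ) (x : E) : ℂ :=
  ((1 + ‖x‖ ^ 2) ^ (r / 2) : ℝ)

theorem hasTemperateGrowth_besselSymbol {E : Type*} [NormedAddCommGroup E]
    [InnerProductSpace ℝ E] (r : ℝ) : (besselSymbol E r).HasTemperateGrowth := by
  unfold besselSymbol
  fun_prop

theorem besselSymbol_mul_neg {E : Type*} [NormedAddCommGroup E] (r : ℝ) :
    besselSymbol E r * besselSymbol E (-r) = fun _ ↦ 1 := by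
  ext x
  simp only [Pi.mul_apply, besselSymbol]
  rw [← Complex.ofReal_mul, ← Real.rpow_add (by positivity)]
  simp [neg_div]

theorem norm_sq_besselSymbol_mul {E : Type*} [NormedAddCommGroup E] (r : ℝ) (x : E) (z : ℂ) :
    ‖besselSymbol E r x * z‖ ^ 2 = (1 + ‖x‖ ^ 2) ^ r * ‖z‖ ^ 2 := by
  rw [norm_mul, mul_pow, besselSymbol, Complex.norm_real, Real.norm_of_nonneg (by positivity),
    ← Real.rpow_natCast, ← Real.rpow_mul (by positivity)]
  norm_num

/-! ### Plancherel and the duality of `H^t` and `H^{-t}` -/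

section Duality

variable {E : Type*} [NormedAddCommGroup E] [InnerProductSpace ℝ E] [FiniteDimensional ℝ E]
  [MeasurableSpace E] [BorelSpace E]

/-- The squared `H^r_2` norm `∫ (1 + ‖ξ‖²)^r ‖𝓕 ψ(ξ)‖² dξ` of a Schwartz function. -/
def sobolevEnergy (r : ℝ) (ψ : 𝓢(E, ℂ)) : ℝ :=
  ∫ x, (1 + ‖x‖ ^ 2) ^ r * ‖𝓕 ψ x‖ ^ 2

theorem norm_toLp_two (ψ : 𝓢(E, ℂ)) : ‖ψ.toLp 2‖ = √(∫ x, ‖ψ x‖ ^ 2) := by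
  rw [SchwartzMap.norm_toLp' two_ne_zero ENNReal.ofNat_ne_top, Real.sqrt_eq_rpow]
  norm_num

theorem norm_besselSymbol_smul_fourier (r : ℝ) (ψ : 𝓢(E, ℂ)) :
    ‖(SchwartzMap.smulLeftCLM ℂ (besselSymbol E r) (𝓕 ψ)).toLp 2‖ = √(sobolevEnergy r ψ) := by
  rw [norm_toLp_two]
  simp_rw [SchwartzMap.smulLeftCLM_apply_apply (hasTemperateGrowth_besselSymbol r), smul_eq_mul,
    norm_sq_besselSymbol_mul]
  rfl

/-- The inverse transform is the reflected forward transform, and the weight is even. -/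
theorem norm_besselSymbol_smul_fourierInv (r : ℝ) (ψ : 𝓢(E, ℂ)) :
    ‖(SchwartzMap.smulLeftCLM ℂ (besselSymbol E r) (𝓕⁻ ψ)).toLp 2‖ = √(sobolevEnergy r ψ) := by
  rw [norm_toLp_two]
  simp_rw [SchwartzMap.smulLeftCLM_apply_apply (hasTemperateGrowth_besselSymbol r), smul_eq_mul,
    norm_sq_besselSymbol_mul, SchwartzMap.fourierInv_coe, Real.fourierInv_eq_fourier_neg]
  rw [sobolevEnergy, ← integral_neg_eq_self]
  simp [SchwartzMap.fourier_coe]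

theorem sobolevENorm_coe (r : ℝ) (ψ : 𝓢(E, ℂ)) :
    sobolevENorm r 2 (ψ : 𝓢'(E, ℂ)) = ENNReal.ofReal (√(sobolevEnergy r ψ)) := by
  have h : besselPotential E ℂ r (ψ : 𝓢'(E, ℂ)) =
      ((𝓕⁻ (SchwartzMap.smulLeftCLM ℂ (besselSymbol E r) (𝓕 ψ))).toLp 2 : 𝓢'(E, ℂ)) := by
    rw [Lp.toTemperedDistribution_toLp_eq]
    exact fourierMultiplierCLM_toTemperedDistributionCLM_eq (hasTemperateGrowth_besselSymbol r) ψ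
  rw [sobolevENorm_eq h, ← norm_besselSymbol_smul_fourier, ← ofReal_norm,
    ← SchwartzMap.norm_fourier_toL2_eq, FourierTransform.fourier_fourierInv_eq]

/-- Cauchy–Schwarz, as Hölder with exponents `2, 2, 1`. -/
theorem norm_toTemperedDistribution_apply_le (g : Lp ℂ 2 (volume : Measure E)) (ψ : 𝓢(E, ℂ)) :
    ‖(g : 𝓢'(E, ℂ)) ψ‖ₑ ≤ ‖ψ.toLp 2‖ₑ * ‖g‖ₑ := by
  rw [Lp.toTemperedDistribution_apply, Lp.enorm_def, Lp.enorm_def]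
  refine (enorm_integral_le_lintegral_enorm _).trans ?_
  rw [← eLpNorm_one_eq_lintegral_enorm, eLpNorm_congr_ae (SchwartzMap.coeFn_toLp ψ 2 volume)]
  exact eLpNorm_smul_le_mul_eLpNorm (p := 2) (q := 2) (r := 1) (f := g) (φ := ψ)
    (Lp.aestronglyMeasurable g) ψ.continuous.aestronglyMeasurable

/-- The duality estimate `|⟨u, ψ⟩| ≤ ‖u‖_{H^t_2} ‖ψ‖_{H^{-t}_2}`. -/
theorem enorm_apply_le_sobolevENorm {t : ℝ} {u : 𝓢'(E, ℂ)} (hu : MemSobolev t 2 u)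
    (ψ : 𝓢(E, ℂ)) :
    ‖u ψ‖ₑ ≤ ENNReal.ofReal (√(sobolevEnergy (-t) ψ)) * sobolevENorm t 2 u := by
  obtain ⟨g, hg⟩ := hu
  -- `χ` is `J_{-t} ψ` in transposed form, so that `⟨u, ψ⟩ = ⟨J_t u, χ⟩`.
  set χ := 𝓕 (SchwartzMap.smulLeftCLM ℂ (besselSymbol E (-t)) (𝓕⁻ ψ)) with hχ
  have huψ : u ψ = (g : 𝓢'(E, ℂ)) χ := by
    rw [← hg]
    change _ = u (𝓕 (SchwartzMap.smulLeftCLM ℂ (besselSymbol E t) (𝓕⁻ χ)))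
    rw [hχ, FourierTransform.fourierInv_fourier_eq, SchwartzMap.smulLeftCLM_smulLeftCLM_apply
      (hasTemperateGrowth_besselSymbol _) (hasTemperateGrowth_besselSymbol _),
      besselSymbol_mul_neg]
    simp
  rw [huψ, sobolevENorm_eq hg]
  refine (norm_toTemperedDistribution_apply_le g χ).trans_eq ?_
  rw [← ofReal_norm (χ.toLp 2 volume), hχ, SchwartzMap.norm_fourier_toL2_eq,
    norm_besselSymbol_smul_fourierInv]

end Duality

/-! ### Sobolev norms of dilated functions -/

section Dilation

variable {E : Type*} [NormedAddCommGroup E] [InnerProductSpace ℝ E] [FiniteDimensional ℝ E]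
  [MeasurableSpace E] [BorelSpace E]

theorem fourier_comp_inv_smul (f : E → ℂ) {ε : ℝ} (hε : 0 < ε) (ξ : E) :
    𝓕 (fun x ↦ f (ε⁻¹ • x)) ξ = (ε ^ Module.finrank ℝ E : ℝ) • 𝓕 f (ε • ξ) := by
  rw [Real.fourier_eq, Real.fourier_eq]
  rw [← abs_of_pos (pow_pos hε (Module.finrank ℝ E)), ← Measure.integral_comp_inv_smul]
  refine integral_congr_ae (Filter.Eventually.of_forall fun x ↦ ?_)
  simp only [inner_smul_left, inner_smul_right]
  simp [hε.ne']

/-- The squared transform contributes `ε^(2n)`, with `n` the dimension; the substitution `x = εξ`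
takes back `ε^n`. -/
theorem sobolevEnergy_dilation (r : ℝ) {ψ χ : 𝓢(E, ℂ)} {ε : ℝ} (hε : 0 < ε)
    (h : ∀ x, χ x = ψ (ε⁻¹ • x)) :
    sobolevEnergy r χ = ε ^ Module.finrank ℝ E *
      ∫ x : E, (1 + ‖ε⁻¹ • x‖ ^ 2) ^ r * ‖𝓕 ψ x‖ ^ 2 := by
  have hχ : ∀ ξ, 𝓕 χ ξ = (ε ^ Module.finrank ℝ E : ℝ) • 𝓕 ψ (ε • ξ) := fun ξ ↦ by
    rw [SchwartzMap.fourier_coe, SchwartzMap.fourier_coe, ← fourier_comp_inv_smul _ hε]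
    exact congrArg (fun f : E → ℂ ↦ 𝓕 f ξ) (funext h)
  have hp := pow_pos hε (Module.finrank ℝ E)
  have key := Measure.integral_comp_smul (volume : Measure E)
    (fun x : E ↦ (1 + ‖ε⁻¹ • x‖ ^ 2) ^ r * ‖𝓕 ψ x‖ ^ 2) ε
  rw [abs_of_pos (inv_pos.2 hp), smul_eq_mul] at key
  rw [sobolevEnergy, ← mul_inv_cancel_left₀ hp.ne' (∫ x : E, (1 + ‖ε⁻¹ • x‖ ^ 2) ^ r * _), ← key,
    ← integral_const_mul, ← integral_const_mul]
  refine integral_congr_ae (Filter.Eventually.of_forall fun x ↦ ?_)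
  simp only [hχ, norm_smul, inv_smul_smul₀ hε.ne', Real.norm_of_nonneg hp.le]
  ring

theorem integrable_mul_norm_sq {f : E → ℂ} (hf : IsTemperedFun f) (ψ : 𝓢(E, ℂ)) :
    Integrable (fun x ↦ ‖f x‖ * ‖ψ x‖ ^ 2) (volume : Measure E) := by
  obtain ⟨C, hC⟩ := ψ.decay 0 0
  have h1 := (hf.integrable_mul ψ).norm.bdd_mul (c := C) (f := fun x ↦ ‖ψ x‖)
    ψ.continuous.norm.aestronglyMeasurable
    (Filter.Eventually.of_forall fun x ↦ by simpa using hC.2 x)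
  refine h1.congr (Filter.Eventually.of_forall fun x ↦ ?_)
  simp only [norm_mul]
  ring

/-- Here `w` is an `ε`-independent majorant of the rescaled weight. It serves both orders: `r = s`,
`a = -s` and `r = -t`, `a = t`. -/
theorem sqrt_sobolevEnergy_dilation_le {r a : ℝ} {w : E → ℝ} {ψ χ : 𝓢(E, ℂ)} {ε : ℝ} (hε : 0 < ε)
    (h : ∀ x, χ x = ψ (ε⁻¹ • x))
    (hw : ∀ᵐ x : E, (1 + ‖ε⁻¹ • x‖ ^ 2) ^ r ≤ ε ^ (2 * a) * w x)
    (hi : Integrable (fun x ↦ w x * ‖𝓕 ψ x‖ ^ 2)) :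
    √(sobolevEnergy r χ) ≤
      √(∫ x, w x * ‖𝓕 ψ x‖ ^ 2) * ε ^ ((Module.finrank ℝ E : ℝ) / 2 + a) := by
  have hle : sobolevEnergy r χ ≤
      (∫ x, w x * ‖𝓕 ψ x‖ ^ 2) * (ε ^ ((Module.finrank ℝ E : ℝ) / 2 + a)) ^ 2 := by
    rw [sobolevEnergy_dilation r hε h, ← Real.rpow_natCast (ε ^ (_ : ℝ)), ← Real.rpow_mul hε.le,
      show ((Module.finrank ℝ E : ℝ) / 2 + a) * (2 : ℕ) = Module.finrank ℝ E + 2 * a by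
        push_cast; ring, Real.rpow_add hε, Real.rpow_natCast, mul_comm (∫ x, w x * _), mul_assoc,
      ← integral_const_mul (ε ^ (2 * a))]
    refine mul_le_mul_of_nonneg_left ?_ (pow_pos hε _).le
    refine integral_mono_of_nonneg (Filter.Eventually.of_forall fun x ↦ by positivity)
      (hi.const_mul _) ?_
    filter_upwards [hw] with x hx
    rw [← mul_assoc]
    exact mul_le_mul_of_nonneg_right hx (by positivity)
  refine (Real.sqrt_le_sqrt hle).trans_eq ?_
  rw [Real.sqrt_mul' _ (by positivity), Real.sqrt_sq (by positivity)]

theorem integrable_rpow_mul_norm_sq (r : ℝ) (ψ : 𝓢(E, ℂ)) :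
    Integrable (fun x ↦ (1 + ‖x‖ ^ 2) ^ r * ‖ψ x‖ ^ 2) (volume : Measure E) := by
  have h := ((SchwartzMap.smulLeftCLM ℂ (besselSymbol E r) ψ).memLp 2
    (volume : Measure E)).integrable_norm_pow two_ne_zero
  simpa only [SchwartzMap.smulLeftCLM_apply_apply (hasTemperateGrowth_besselSymbol r), smul_eq_mul,
    norm_sq_besselSymbol_mul] using h

/-- For `ε ≤ 1`, `1 + ‖x/ε‖² ≤ ε⁻²(1 + ‖x‖²)`. -/
theorem exists_sqrt_sobolevEnergy_dilation_le {s : ℝ} (hs : 0 ≤ s) (ψ : 𝓢(E, ℂ)) :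
    ∃ K : ℝ, ∀ (ε : ℝ) (χ : 𝓢(E, ℂ)), 0 < ε → ε ≤ 1 → (∀ x, χ x = ψ (ε⁻¹ • x)) →
      √(sobolevEnergy s χ) ≤ K * ε ^ ((Module.finrank ℝ E : ℝ) / 2 - s) := by
  refine ⟨√(∫ x, (1 + ‖x‖ ^ 2) ^ s * ‖𝓕 ψ x‖ ^ 2), fun ε χ hε hε1 h ↦ ?_⟩
  rw [sub_eq_add_neg]
  refine sqrt_sobolevEnergy_dilation_le hε h (Filter.Eventually.of_forall fun x ↦ ?_)
    (integrable_rpow_mul_norm_sq s (𝓕 ψ))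
  have hinv : 1 ≤ (ε ^ 2)⁻¹ := (one_le_inv₀ (by positivity)).2 (pow_le_one₀ hε.le hε1)
  calc (1 + ‖ε⁻¹ • x‖ ^ 2) ^ s ≤ ((ε ^ 2)⁻¹ * (1 + ‖x‖ ^ 2)) ^ s := by
        refine Real.rpow_le_rpow (by positivity) ?_ hs
        rw [norm_smul, Real.norm_of_nonneg (by positivity), mul_pow, inv_pow, mul_add, mul_one]
        gcongr
    _ = ε ^ (2 * -s) * (1 + ‖x‖ ^ 2) ^ s := by
        rw [Real.mul_rpow (by positivity) (by positivity), Real.rpow_mul hε.le,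
          Real.rpow_neg (by positivity), Real.inv_rpow (by positivity), Real.rpow_two]

theorem norm_powFun {n : ℕ} {α : ℝ} {x : EuclideanSpace ℝ (Fin n)} (hx : x ≠ 0) :
    ‖powFun n α x‖ = ‖x‖ ^ (-α) := by
  rw [powFun, if_neg hx, Complex.norm_real, Real.norm_of_nonneg (by positivity),
    Real.rpow_neg (norm_nonneg x), one_div]

/-- Dropping the `1` bounds the weight by the homogeneous `ε^(2t)‖x‖^(-2t)`, which is locally
integrable because `2t < n`. -/
theorem exists_sqrt_sobolevEnergy_neg_dilation_le {n : ℕ} {t : ℝ} (ht : 0 < t) (htn : t < n / 2)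
    (ψ : 𝓢(EuclideanSpace ℝ (Fin n), ℂ)) :
    ∃ K : ℝ, ∀ (ε : ℝ) (χ : 𝓢(EuclideanSpace ℝ (Fin n), ℂ)), 0 < ε →
      (∀ x, χ x = ψ (ε⁻¹ • x)) →
      √(sobolevEnergy (-t) χ) ≤ K * ε ^ ((n : ℝ) / 2 + t) := by
  refine ⟨√(∫ x, ‖powFun n (2 * t) x‖ * ‖𝓕 ψ x‖ ^ 2), fun ε χ hε h ↦ ?_⟩
  have hn : 0 < n := by
    have : (0 : ℝ) < n := by linarith
    exact_mod_cast this
  have : NeZero n := ⟨hn.ne'⟩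
  -- The majorant fails at the origin, where `powFun` is `0` by convention.
  have hne : ∀ᵐ x : EuclideanSpace ℝ (Fin n), x ≠ 0 := by
    simp [ae_iff]
  have key := sqrt_sobolevEnergy_dilation_le (r := -t) (a := t)
    (w := fun x ↦ ‖powFun n (2 * t) x‖) hε h ?_
    (integrable_mul_norm_sq (isTemperedFun_powFun (by linarith) (by linarith)) (𝓕 ψ))
  · simpa using key
  filter_upwards [hne] with x hx
  have hx' : 0 < ‖x‖ := norm_pos_iff.2 hx
  calc (1 + ‖ε⁻¹ • x‖ ^ 2) ^ (-t) ≤ ((ε⁻¹ * ‖x‖) ^ 2) ^ (-t) := by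
        refine Real.rpow_le_rpow_of_nonpos (by positivity) ?_ (by linarith)
        rw [norm_smul, Real.norm_of_nonneg (by positivity)]
        linarith
    _ = ε ^ (2 * t) * ‖powFun n (2 * t) x‖ := by
        rw [norm_powFun hx, ← Real.rpow_natCast, ← Real.rpow_mul (by positivity),
          Real.mul_rpow (by positivity) hx'.le, Real.inv_rpow hε.le, ← Real.rpow_neg hε.le]
        congr 2 <;> (push_cast; ring)

end Dilation

/-! ### The pairing with `|x|^{-α}` -/

theorem powFun_eq_rpow_mul {n : ℕ} (α : ℝ) {ε : ℝ} (hε : 0 < ε) (x : EuclideanSpace ℝ (Fin n)) :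
    powFun n α x = (ε ^ (-α) : ℝ) * powFun n α (ε⁻¹ • x) := by
  rcases eq_or_ne x 0 with rfl | hx
  · simp [powFun]
  · rw [powFun, powFun, if_neg hx, if_neg (smul_ne_zero (inv_ne_zero hε.ne') hx),
      ← Complex.ofReal_mul, norm_smul, Real.norm_of_nonneg (by positivity),
      Real.mul_rpow (by positivity) (norm_nonneg x), Real.inv_rpow hε.le, Real.rpow_neg hε.le]
    have := Real.rpow_pos_of_pos hε α
    congr 1
    field_simp

/-- The pairing of `φ(·/ε) η |x|^{-α}` with `φ(·/ε)`, for `φ` vanishing off the unit ball. -/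
theorem smulLeftCLM_powDistribution_dilation {n : ℕ} {α : ℝ} (h0 : 0 < α) (hn : α < n)
    {η : EuclideanSpace ℝ (Fin n) → ℝ} (hη : ContDiff ℝ ∞ η) (hηc : HasCompactSupport η)
    (hη1 : ∀ x ∈ Metric.ball (0 : EuclideanSpace ℝ (Fin n)) 1, η x = 1)
    {φ : EuclideanSpace ℝ (Fin n) → ℂ} (hφ : ∀ x ∉ Metric.ball 0 1, φ x = 0)
    {ε : ℝ} (hε : 0 < ε) (hε1 : ε ≤ 1) {f : EuclideanSpace ℝ (Fin n) → ℂ}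
    (hf : f.HasTemperateGrowth) (ψ : 𝓢(EuclideanSpace ℝ (Fin n), ℂ))
    (hfφ : ∀ x, f x = φ (ε⁻¹ • x)) (hψφ : ∀ x, ψ x = φ (ε⁻¹ • x)) :
    smulLeftCLM ℂ f (smulLeftCLM ℂ (fun x ↦ (η x : ℂ)) (powDistribution n α h0 hn)) ψ =
      (ε ^ ((n : ℝ) - α) : ℝ) * ∫ x, φ x ^ 2 * powFun n α x := by
  have hηg : (fun x ↦ (η x : ℂ)).HasTemperateGrowth :=
    (hηc.comp_left (g := fun y : ℝ ↦ (y : ℂ)) Complex.ofReal_zero).hasTemperateGrowth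
      (Complex.ofRealCLM.contDiff.comp hη)
  rw [smulLeftCLM_apply_apply, smulLeftCLM_apply_apply, powDistribution, regularDistribution_apply]
  have hint : ∀ x, SchwartzMap.smulLeftCLM ℂ (fun x ↦ (η x : ℂ)) (SchwartzMap.smulLeftCLM ℂ f ψ) x *
      powFun n α x = (ε ^ (-α) : ℝ) * (φ (ε⁻¹ • x) ^ 2 * powFun n α (ε⁻¹ • x)) := fun x ↦ by
    rw [SchwartzMap.smulLeftCLM_apply_apply hηg, SchwartzMap.smulLeftCLM_apply_apply hf, hfφ, hψφ,
      powFun_eq_rpow_mul α hε x, smul_eq_mul, smul_eq_mul]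
    -- Where `‖x‖ < ε ≤ 1` the cutoff `η` is `1`; elsewhere both sides vanish.
    by_cases hx : ε⁻¹ • x ∈ Metric.ball 0 1
    · rw [hη1 x]
      · push_cast
        ring
      · rw [mem_ball_zero_iff, norm_smul, Real.norm_of_nonneg (by positivity),
          inv_mul_lt_iff₀ hε] at hx
        rw [mem_ball_zero_iff]
        linarith
    · simp [hφ _ hx]
  simp_rw [hint]
  rw [integral_const_mul, Measure.integral_comp_inv_smul volume
    (fun x ↦ φ x ^ 2 * powFun n α x), finrank_euclideanSpace_fin, abs_of_pos (pow_pos hε n),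
    Complex.real_smul, ← mul_assoc, ← Complex.ofReal_mul, ← Real.rpow_natCast,
    ← Real.rpow_add hε, neg_add_eq_sub]

/-- The integrand is nonnegative, and positive on a punctured ball. -/
theorem integral_bump_sq_mul_powFun_ne_zero {n : ℕ} {α : ℝ} (h0 : 0 < α) (hn : α < n)
    (φ : ContDiffBump (0 : EuclideanSpace ℝ (Fin n))) :
    ∫ x, (φ x : ℂ) ^ 2 * powFun n α x ≠ 0 := by
  have : NeZero n := ⟨by
    rintro rfl
    simp only [Nat.cast_zero] at hn
    linarith⟩
  have hφc : HasCompactSupport (fun x ↦ (φ x : ℂ)) :=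
    φ.hasCompactSupport.comp_left (g := fun y : ℝ ↦ (y : ℂ)) Complex.ofReal_zero
  set ψ := hφc.toSchwartzMap (Complex.ofRealCLM.contDiff.comp φ.contDiff)
  have hi := integrable_mul_norm_sq (isTemperedFun_powFun h0 hn) ψ
  have heq : ∀ x, (φ x : ℂ) ^ 2 * powFun n α x = ((‖powFun n α x‖ * ‖ψ x‖ ^ 2 : ℝ) : ℂ) := by
    intro x
    have h1 : ‖ψ x‖ = φ x := by
      change ‖(φ x : ℂ)‖ = _
      rw [Complex.norm_real, Real.norm_of_nonneg φ.nonneg]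
    have h2 : powFun n α x = (‖powFun n α x‖ : ℂ) := by
      unfold powFun
      split_ifs
      · simp
      · rw [Complex.norm_real, Real.norm_of_nonneg (by positivity)]
    rw [h1, Complex.ofReal_mul, ← h2, Complex.ofReal_pow, mul_comm]
  simp_rw [heq]
  rw [integral_complex_ofReal, Complex.ofReal_ne_zero]
  refine ((integral_pos_iff_support_of_nonneg (fun x ↦ by positivity) hi).2 ?_).ne'
  have hsub : Metric.ball (0 : EuclideanSpace ℝ (Fin n)) φ.rOut \ {0} ⊆
      Function.support fun x ↦ ‖powFun n α x‖ * ‖ψ x‖ ^ 2 := by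
    rintro x ⟨hx, hx0⟩
    have hx0 : x ≠ 0 := hx0
    have h1 : ψ x ≠ 0 := by
      change (φ x : ℂ) ≠ 0
      rw [Complex.ofReal_ne_zero]
      exact (φ.pos_of_mem_ball hx).ne'
    have h2 : ‖powFun n α x‖ ≠ 0 := by
      rw [norm_powFun hx0]
      exact (Real.rpow_pos_of_pos (norm_pos_iff.2 hx0) _).ne'
    exact mul_ne_zero h2 (pow_ne_zero _ (norm_ne_zero_iff.2 h1))
  refine lt_of_lt_of_le ?_ (measure_mono hsub)
  rw [measure_sdiff_null (measure_singleton _)]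
  exact Metric.measure_ball_pos _ _ φ.rOut_pos

/-- A positive constant is not dominated by positive powers of small numbers. -/
theorem nonpos_of_forall_le_mul_rpow {c K a : ℝ} (hc : 0 < c)
    (h : ∀ ε : ℝ, 0 < ε → ε ≤ 1 → c ≤ K * ε ^ a) : a ≤ 0 := by
  by_contra! ha
  have hlim : Filter.Tendsto (fun ε : ℝ ↦ K * ε ^ a) (nhdsWithin 0 (Set.Ioi 0)) (nhds 0) := by
    have h1 : ContinuousAt (fun ε : ℝ ↦ K * ε ^ a) 0 :=
      continuousAt_const.mul (Real.continuousAt_rpow_const 0 a (Or.inr ha.le))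
    have h2 := h1.tendsto
    simp only [Real.zero_rpow ha.ne', mul_zero] at h2
    exact h2.mono_left nhdsWithin_le_nhds
  refine hc.not_ge (ge_of_tendsto hlim ?_)
  filter_upwards [Ioc_mem_nhdsGT (zero_lt_one (α := ℝ))] with ε hε
  exact h ε hε.1 hε.2

end BesselMultiplier

end

/-! ### Comparison of powers of `ε` -/

theorem mainTheorem3 (n : ℕ) (s t α : ℝ)
    (hs0 : 0 < s) (hsn : s < n / 2) (ht0 : 0 < t) (htn : t < n / 2) (hst : t < s)
    (η : EuclideanSpace ℝ (Fin n) → ℝ) (hη : ContDiff ℝ ∞ η) (hηc : HasCompactSupport η)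
    (hη01 : ∀ x, 0 ≤ η x ∧ η x ≤ 1)
    (hη1 : ∀ x ∈ Metric.ball (0 : EuclideanSpace ℝ (Fin n)) 1, η x = 1)
    (hη2 : ∀ x ∉ Metric.ball (0 : EuclideanSpace ℝ (Fin n)) 2, η x = 0)
    (hα0 : 0 < α) (hαn : α < n / 2)
    (hmult : BesselMultiplier.IsMultiplier s 2 t 2
      (smulLeftCLM ℂ (fun x ↦ (η x : ℂ))
        (BesselMultiplier.powDistribution n α hα0
          (hαn.trans_le (half_le_self (Nat.cast_nonneg n)))))) :
    α ≤ s - t := by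
  obtain ⟨hloc, C, hC⟩ := hmult
  have hαn' : α < n := hαn.trans_le (half_le_self (Nat.cast_nonneg n))
  -- The outer radius `1` matches the ball on which `η = 1`; the inner radius is immaterial.
  let φ : ContDiffBump (0 : EuclideanSpace ℝ (Fin n)) := ⟨1 / 2, 1, by norm_num, by norm_num⟩
  have hφ0 : ∀ x ∉ Metric.ball (0 : EuclideanSpace ℝ (Fin n)) 1, (φ x : ℂ) = 0 := fun x hx ↦ by
    rw [φ.zero_of_le_dist (by simpa using hx), Complex.ofReal_zero]
  have hφd : ContDiff ℝ ∞ (fun x ↦ (φ x : ℂ)) := Complex.ofRealCLM.contDiff.comp φ.contDiff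
  have hφc : HasCompactSupport (fun x ↦ (φ x : ℂ)) :=
    φ.hasCompactSupport.comp_left (g := fun y : ℝ ↦ (y : ℂ)) Complex.ofReal_zero
  obtain ⟨K₁, hK₁⟩ := BesselMultiplier.exists_sqrt_sobolevEnergy_dilation_le hs0.le (hφc.toSchwartzMap hφd)
  obtain ⟨K₂, hK₂⟩ := BesselMultiplier.exists_sqrt_sobolevEnergy_neg_dilation_le ht0 htn (hφc.toSchwartzMap hφd)
  set c := ‖∫ x, (φ x : ℂ) ^ 2 * BesselMultiplier.powFun n α x‖
  have hc : 0 < c := norm_pos_iff.2 (BesselMultiplier.integral_bump_sq_mul_powFun_ne_zero hα0 hαn' φ)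
  rw [← sub_nonpos]
  refine BesselMultiplier.nonpos_of_forall_le_mul_rpow (K := K₂ * (C * K₁)) hc fun ε hε hε1 ↦ ?_
  have hfd : ContDiff ℝ ∞ (fun x ↦ (φ (ε⁻¹ • x) : ℂ)) := hφd.comp (contDiff_const_smul _)
  have hfc : HasCompactSupport (fun x ↦ (φ (ε⁻¹ • x) : ℂ)) :=
    hφc.comp_homeomorph (Homeomorph.smulOfNeZero ε⁻¹ (inv_ne_zero hε.ne'))
  set ψ := hfc.toSchwartzMap hfd
  have hψ : ∀ x, ψ x = hφc.toSchwartzMap hφd (ε⁻¹ • x) := fun _ ↦ rfl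
  -- The dilated bump is both the multiplied function and the test function.
  have hdual := (BesselMultiplier.enorm_apply_le_sobolevENorm (hloc _ hfd hfc) ψ).trans
    (mul_le_mul_right (hC _ hfd hfc) _)
  rw [BesselMultiplier.smulLeftCLM_powDistribution_dilation hα0 hαn' hη hηc hη1 hφ0 hε hε1
    (hfc.hasTemperateGrowth hfd) ψ (fun _ ↦ rfl) (fun _ ↦ rfl), BesselMultiplier.sobolevENorm_coe,
    ← ENNReal.ofReal_coe_nnreal, ← ENNReal.ofReal_mul C.coe_nonneg, ← ENNReal.ofReal_mul (Real.sqrt_nonneg _),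
    ← ofReal_norm, ENNReal.ofReal_le_ofReal_iff (by positivity), norm_mul, Complex.norm_real,
    Real.norm_of_nonneg (by positivity)] at hdual
  have h1 := hK₁ ε ψ hε hε1 hψ
  have h2 := hK₂ ε ψ hε hψ
  rw [finrank_euclideanSpace_fin] at h1
  have h3 : ε ^ ((n : ℝ) - α) * c ≤
      (K₂ * ε ^ ((n : ℝ) / 2 + t)) * (C * (K₁ * ε ^ ((n : ℝ) / 2 - s))) :=
    hdual.trans (mul_le_mul h2 (mul_le_mul_of_nonneg_left h1 C.coe_nonneg) (by positivity)
      ((Real.sqrt_nonneg _).trans h2))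
  have hpow : ε ^ ((n : ℝ) / 2 + t) * ε ^ ((n : ℝ) / 2 - s) =
      ε ^ ((n : ℝ) - α) * ε ^ (α - (s - t)) := by
    rw [← Real.rpow_add hε, ← Real.rpow_add hε]
    congr 1
    ring
  refine le_of_mul_le_mul_left ?_ (Real.rpow_pos_of_pos hε ((n : ℝ) - α))
  calc ε ^ ((n : ℝ) - α) * c
      ≤ K₂ * (C * K₁) * (ε ^ ((n : ℝ) / 2 + t) * ε ^ ((n : ℝ) / 2 - s)) := by
        refine h3.trans_eq ?_
        ring
    _ = ε ^ ((n : ℝ) - α) * (K₂ * (C * K₁) * ε ^ (α - (s - t))) := by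
        rw [hpow]
        ring
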